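/- Let $\Gamma$ be a (not necessarily commutative) monoid and let $A=\bigoplus_{\gamma\in\Gamma}A_\gamma$ be a $\Gamma$-graded (associative, unital) $\mathbf C$-algebra. For each $\gamma\in\Gamma$ let $\tau_\gamma$ be a graded algebra automorphism of $A$ (that is, $\tau_\gamma(A_\delta)=A_\delta$ for all $\delta\in\Gamma$), such that $\tau_{\gamma\gamma'}=\tau_\gamma\tau_{\gamma'}$ for all $\gamma,\gamma'\in\Gamma$. Let $A^\tau$ be the twisted algebra, i.e. the vector space $\bigoplus_{\gamma\in\Gamma}A_\gamma$ with the multiplication determined by \[ x*y:=x\,\tau_\gamma(y)\qquad\text{for all } x\in A_\gamma,\ y\in A . \] Let $h:\Gamma\to\mathbf N$ be a morphism of monoids (with $\mathbf N=\{0,1,2,\dots\}$ under addition), and consider $A$ and $A^\tau$ as $\mathbf N$-graded algebras with components $A_n=A^\tau_n=\bigoplus_{h(\gamma)=n}A_\gamma$. Assume that $A$ and $A^\tau$ are both generated, as $\mathbf C$-algebras, by $A_1=A_1^\tau$. Then $A^\tau$ is Koszul if and only if $A$ is Koszul. Here an $\mathbf N$-graded algebra $B=\bigoplus_{n\ge0}B_n$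 is called Koszul if $B_0$ is semisimple and the graded left $B$-module $B_0=B/\bigoplus_{n>0}B_n$, placed in degree $0$, admits a resolution \[ \cdots\to P^2\to P^1\to P^0\to B_0\to 0 \] by graded projective left $B$-modules, with maps of degree $0$, such that each $P^i$ is generated by its component of degree $i$. -/

import Mathlib

open scoped DirectSum

universe u v

noncomputable section

section Twist

variable {Γ : Type v} [AddMonoid Γ] {A : Type u} [Ring A] [Algebra ℂ A]

/-- For a family `𝒜 : Γ → Submodule ℂ A` (the homogeneous components of a `Γ`-graded algebra, the
monoid `Γ` being written additively but not assumed commutative): a family of graded algebra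
automorphisms `τ γ` of `A` that is multiplicative in `γ`. Multiplication in `A ≃ₐ[ℂ] A` is
composition. -/
structure TwistingFamily (𝒜 : Γ → Submodule ℂ A) where
  /-- The automorphism attached to an element of the monoid. -/
  aut : Γ → (A ≃ₐ[ℂ] A)
  /-- Each automorphism is graded, i.e. preserves every homogeneous component. -/
  map_mem : ∀ (γ δ : Γ) (x : A), x ∈ 𝒜 δ → aut γ x ∈ 𝒜 δ
  /-- Multiplicativity. -/
  map_add : ∀ γ δ : Γ, aut (γ + δ) = aut γ * aut δ

/-- The underlying vector space of the twisted algebra: it is that of `A`. -/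
def Twist {𝒜 : Γ → Submodule ℂ A} (_τ : TwistingFamily 𝒜) : Type u := A

namespace TwistingFamily

variable {𝒜 : Γ → Submodule ℂ A} (τ : TwistingFamily 𝒜)

theorem aut_zero : τ.aut 0 = 1 := by
  have h := τ.map_add 0 0
  rw [add_zero] at h
  exact (mul_eq_left.mp h.symm)

variable [DecidableEq Γ] [GradedAlgebra 𝒜]

/-- The bilinear map on `A` given by `(x, y) ↦ x * τ_γ(y)` for `x` of degree `γ`. -/
def mulMap : A →ₗ[ℂ] A →ₗ[ℂ] A :=
  DirectSum.toModule ℂ Γ (A →ₗ[ℂ] A)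
      (fun γ => (LinearMap.mul ℂ A).compl₂ (τ.aut γ).toLinearMap ∘ₗ (𝒜 γ).subtype) ∘ₗ
    (DirectSum.decomposeLinearEquiv 𝒜).toLinearMap

theorem mulMap_of_mem {γ : Γ} {x : A} (hx : x ∈ 𝒜 γ) (y : A) :
    τ.mulMap x y = x * τ.aut γ y := by
  lift x to 𝒜 γ using hx
  simp [mulMap]

theorem mulMap_mem {γ δ : Γ} {x y : A} (hx : x ∈ 𝒜 γ) (hy : y ∈ 𝒜 δ) :
    τ.mulMap x y ∈ 𝒜 (γ + δ) := by
  rw [τ.mulMap_of_mem hx]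
  exact SetLike.mul_mem_graded hx (τ.map_mem _ _ _ hy)

theorem mulMap_assoc (x y z : A) :
    τ.mulMap (τ.mulMap x y) z = τ.mulMap x (τ.mulMap y z) := by
  induction x using DirectSum.Decomposition.inductionOn 𝒜 with
  | zero => simp
  | add a b ha hb => simp only [_root_.map_add, LinearMap.add_apply, ha, hb]
  | homogeneous x =>
    induction y using DirectSum.Decomposition.inductionOn 𝒜 with
    | zero => simp
    | add a b ha hb => simp only [_root_.map_add, LinearMap.add_apply, ha, hb]
    | homogeneous y =>
      rw [τ.mulMap_of_mem (τ.mulMap_mem x.2 y.2), τ.mulMap_of_mem x.2, τ.mulMap_of_mem x.2,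
        τ.mulMap_of_mem y.2, map_mul, τ.map_add, AlgEquiv.mul_apply, mul_assoc]

theorem one_mulMap (x : A) : τ.mulMap 1 x = x := by
  rw [τ.mulMap_of_mem SetLike.GradedOne.one_mem, τ.aut_zero, one_mul, AlgEquiv.one_apply]

theorem mulMap_one (x : A) : τ.mulMap x 1 = x := by
  induction x using DirectSum.Decomposition.inductionOn 𝒜 with
  | zero => simp
  | add a b ha hb => simp only [_root_.map_add, LinearMap.add_apply, ha, hb]
  | homogeneous x => rw [τ.mulMap_of_mem x.2, map_one, mul_one]

end TwistingFamily

namespace Twist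

variable {𝒜 : Γ → Submodule ℂ A} (τ : TwistingFamily 𝒜)

instance : AddCommGroup (Twist τ) := inferInstanceAs (AddCommGroup A)

instance : Module ℂ (Twist τ) := inferInstanceAs (Module ℂ A)

/-- The identity map, from the algebra to its twist. -/
def of : A ≃ₗ[ℂ] Twist τ := LinearEquiv.refl ℂ A

/-- The homogeneous components of the twisted algebra: the same subspaces as those of `A`. -/
def grading (γ : Γ) : Submodule ℂ (Twist τ) := (𝒜 γ).map (of τ).toLinearMap

variable [DecidableEq Γ] [GradedAlgebra 𝒜]

/-- The twisted algebra: its product is `x * y = x τ_γ(y)` for `x` of degree `γ`. -/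
instance : Ring (Twist τ) where
  __ := (inferInstance : AddCommGroup (Twist τ))
  one := of τ 1
  mul x y := of τ (τ.mulMap ((of τ).symm x) ((of τ).symm y))
  mul_assoc x y z := τ.mulMap_assoc x y z
  one_mul x := τ.one_mulMap x
  mul_one x := τ.mulMap_one x
  zero_mul x := LinearMap.map_zero₂ τ.mulMap x
  mul_zero x := map_zero (τ.mulMap x)
  left_distrib x y z := map_add (τ.mulMap x) y z
  right_distrib x y z := LinearMap.map_add₂ τ.mulMap x y z

theorem of_mul_of {γ : Γ} {x : A} (hx : x ∈ 𝒜 γ) (y : A) :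
    of τ x * of τ y = of τ (x * τ.aut γ y) :=
  congrArg (of τ) (τ.mulMap_of_mem hx y)

instance : Algebra ℂ (Twist τ) :=
  Algebra.ofModule (fun r x y => LinearMap.map_smul₂ τ.mulMap r x y)
    (fun r x y => map_smul (τ.mulMap x) r y)

/-- The twisted algebra is again `Γ`-graded. -/
instance : GradedAlgebra (grading τ) where
  one_mem := ⟨1, SetLike.GradedOne.one_mem, rfl⟩
  mul_mem := by
    rintro γ δ _ _ ⟨x, hx, rfl⟩ ⟨y, hy, rfl⟩
    exact ⟨τ.mulMap x y, τ.mulMap_mem hx hy, rfl⟩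
  __ := DirectSum.Decomposition.ofLinearMap (grading τ)
    (DirectSum.toModule ℂ Γ (⨁ γ, grading τ γ)
        (fun γ => DirectSum.lof ℂ Γ (fun γ => grading τ γ) γ ∘ₗ
          ((of τ).submoduleMap (𝒜 γ)).toLinearMap) ∘ₗ
      (DirectSum.decomposeLinearEquiv 𝒜).toLinearMap ∘ₗ (of τ).symm.toLinearMap)
    (by
      ext x
      obtain ⟨x, rfl⟩ := (of τ).surjective x
      induction x using DirectSum.Decomposition.inductionOn 𝒜 with
      | zero => simp
      | add a b ha hb => simp only [map_add, ha, hb]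
      | homogeneous x =>
        simp only [LinearMap.comp_apply, LinearEquiv.coe_coe, LinearEquiv.symm_apply_apply,
          DirectSum.decomposeLinearEquiv_apply, DirectSum.decompose_coe, ← DirectSum.lof_eq_of ℂ,
          DirectSum.toModule_lof]
        exact DirectSum.coeLinearMap_lof (grading τ) _ _)
    (by
      ext γ ⟨_, x, hx, rfl⟩ : 2
      lift x to 𝒜 γ using hx
      simp
      rfl)

end Twist

end Twist

section Coarsen

variable {Γ : Type v} [AddMonoid Γ] {A : Type u} [Ring A] [Algebra ℂ A]

/-- The components `A_n = ⨁_{h(γ) = n} A_γ` obtained from a `Γ`-grading through `h : Γ → ℕ`. -/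
def coarsen (𝒜 : Γ → Submodule ℂ A) (h : Γ →+ ℕ) (n : ℕ) : Submodule ℂ A :=
  ⨆ γ : {γ : Γ // h γ = n}, 𝒜 γ

variable (𝒜 : Γ → Submodule ℂ A) (h : Γ →+ ℕ)

theorem le_coarsen (γ : Γ) : 𝒜 γ ≤ coarsen 𝒜 h (h γ) :=
  le_iSup (fun δ : {δ : Γ // h δ = h γ} => 𝒜 δ) ⟨γ, rfl⟩

variable [DecidableEq Γ] [GradedAlgebra 𝒜]

/-- The `ℕ`-graded algebra underlying a `Γ`-graded algebra. -/
instance : GradedAlgebra (coarsen 𝒜 h) where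
  one_mem := by
    have := le_coarsen 𝒜 h 0 (SetLike.GradedOne.one_mem (A := 𝒜))
    rwa [map_zero] at this
  mul_mem := by
    intro m n x y hx hy
    refine Submodule.iSup_induction _ (motive := fun x => x * y ∈ coarsen 𝒜 h (m + n)) hx
      ?_ (by simp) (fun a b ha hb => by rw [add_mul]; exact add_mem ha hb)
    rintro ⟨γ, rfl⟩ x hx
    refine Submodule.iSup_induction _ (motive := fun y => x * y ∈ coarsen 𝒜 h (h γ + n)) hy
      ?_ (by simp) (fun a b ha hb => by rw [mul_add]; exact add_mem ha hb)
    rintro ⟨δ, rfl⟩ y hy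
    rw [← map_add]
    exact le_coarsen 𝒜 h _ (SetLike.mul_mem_graded hx hy)
  __ := DirectSum.Decomposition.ofLinearMap (coarsen 𝒜 h)
    (DirectSum.toModule ℂ Γ (⨁ n, coarsen 𝒜 h n)
        (fun γ => DirectSum.lof ℂ ℕ (fun n => coarsen 𝒜 h n) (h γ) ∘ₗ
          Submodule.inclusion (le_coarsen 𝒜 h γ)) ∘ₗ
      (DirectSum.decomposeLinearEquiv 𝒜).toLinearMap)
    (by
      ext x
      induction x using DirectSum.Decomposition.inductionOn 𝒜 with
      | zero => simp
      | add a b ha hb => simp only [map_add, ha, hb]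
      | homogeneous x => simp)
    (by
      ext n ⟨x, hx⟩ : 2
      simp only [LinearMap.comp_apply, DirectSum.coeLinearMap_lof, LinearMap.id_apply]
      induction hx using Submodule.iSup_induction' with
      | zero => simp; exact (map_zero (DirectSum.lof ℂ ℕ (fun n => coarsen 𝒜 h n) n)).symm
      | add a b ha hb iha ihb =>
        simp only [map_add, iha, ihb]
        exact (map_add (DirectSum.lof ℂ ℕ (fun n => coarsen 𝒜 h n) n) ⟨a, ha⟩ ⟨b, hb⟩).symm
      | mem γ x hx =>
        obtain ⟨γ, rfl⟩ := γ
        lift x to 𝒜 γ using hx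
        simp
        rfl)

end Coarsen

section Koszul

variable {A : Type u} [Ring A] [Algebra ℂ A]

/-- A linear resolution over an `ℕ`-graded algebra `A`: an exact sequence
`⋯ ⟶ P 2 ⟶ P 1 ⟶ P 0 ⟶ A / A_{>0} ⟶ 0` of graded left `A`-modules and `A`-linear maps of degree
`0`, each `P i` being projective and generated by its component of degree `i`. The module
`A / A_{>0}`, i.e. `A_0`, sits in degree `0`. As `A` lives in degrees `≥ 0`, a module generated in
degree `i ≥ 0` has no components of negative degree, so gradings by `ℕ` suffice. -/
structure LinearResolution (𝒜 : ℕ → Submodule ℂ A) [GradedAlgebra 𝒜] where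
  /-- The terms of the resolution. -/
  P : ℕ → Type u
  [addCommGroup : ∀ i, AddCommGroup (P i)]
  [moduleComplex : ∀ i, Module ℂ (P i)]
  [module : ∀ i, Module A (P i)]
  [isScalarTower : ∀ i, IsScalarTower ℂ A (P i)]
  /-- `deg i j` is the component of degree `j` of `P i`. -/
  deg : ∀ i, ℕ → Submodule ℂ (P i)
  isInternal : ∀ i, DirectSum.IsInternal (deg i)
  smul_mem : ∀ (i m n : ℕ) (a : A) (x : P i), a ∈ 𝒜 m → x ∈ deg i n → a • x ∈ deg i (m + n)
  projective : ∀ i, Module.Projective A (P i)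
  generated : ∀ i, Submodule.span A (deg i i : Set (P i)) = ⊤
  /-- The differentials. -/
  d : ∀ i, P (i + 1) →ₗ[A] P i
  d_mem : ∀ (i j : ℕ) (x : P (i + 1)), x ∈ deg (i + 1) j → d i x ∈ deg i j
  /-- The augmentation. -/
  ε : P 0 →ₗ[A] A ⧸ (HomogeneousIdeal.irrelevant 𝒜).toIdeal
  ε_eq_zero : ∀ (j : ℕ) (x : P 0), j ≠ 0 → x ∈ deg 0 j → ε x = 0
  exact_d : ∀ i, Function.Exact (d (i + 1)) (d i)
  exact_ε : Function.Exact (d 0) ε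
  surjective_ε : Function.Surjective ε

/-- An `ℕ`-graded algebra `A` is Koszul if `A_0` is semisimple and the graded left `A`-module
`A_0 = A / A_{>0}` has a graded projective resolution whose `i`-th term is generated in
degree `i`. -/
def IsKoszul (𝒜 : ℕ → Submodule ℂ A) [GradedAlgebra 𝒜] : Prop :=
  IsSemisimpleRing (𝒜 0) ∧ Nonempty (LinearResolution 𝒜)

end Koszul

end

/-!
A Zhang twist can be inverted once it is described symmetrically (`ZhangEquiv`), so Koszulness only
has to be carried from `A` to `B`. An algebra generated in degree `1` has only scalars in degree
`0`, whence a projective graded module generated in degree `i` is induced from its component of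
degree `i`: `P i ≅ A ⊗ V i`, by a graded Nakayama argument. Along the resolution one constructs, for
all `γ` at once, twisted linear equivalences `φ γ : P i ≃ B ⊗ V i`. Since `V (i + 1)` embeds into
`P i` and the image of `V (i + 1)` under `φ γ` does not depend on `γ`, the differential pulls `φ`
back to the next term and thereby becomes `B`-linear.
-/

noncomputable section

open scoped TensorProduct

section GradedModule

theorem inf_iSup_eq_of_iSupIndep_of_le {α ι : Type*} [CompleteLattice α] [IsModularLattice α]
    {s t : ι → α} (ht : iSupIndep t) (hst : s ≤ t) (i : ι) : (t i ⊓ ⨆ j, s j) = s i := by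
  have hdisjoint : (⨆ (j) (_ : j ≠ i), s j) ⊓ t i = ⊥ :=
    ((ht i).mono_right (iSup₂_mono fun j _ => hst j)).symm.eq_bot
  rw [iSup_split_single s i, inf_comm, sup_inf_assoc_of_le _ (hst i), hdisjoint, sup_bot_eq]

theorem map_eq_inf_range_of_isInternal {ι R M N : Type*} [DecidableEq ι] [Ring R]
    [AddCommGroup M] [Module R M] [AddCommGroup N] [Module R N] {D : ι → Submodule R M}
    {E : ι → Submodule R N} (hD : DirectSum.IsInternal D) (hE : DirectSum.IsInternal E)
    {f : M →ₗ[R] N} (hf : ∀ i, (D i).map f ≤ E i) (i : ι) :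
    (D i).map f = E i ⊓ LinearMap.range f := by
  rw [LinearMap.range_eq_map, ← hD.submodule_iSup_eq_top, Submodule.map_iSup,
    inf_iSup_eq_of_iSupIndep_of_le hE.submodule_iSupIndep hf]

theorem isInternal_map_equiv {ι R M N : Type*} [DecidableEq ι] [Ring R] [AddCommGroup M]
    [Module R M] [AddCommGroup N] [Module R N] {D : ι → Submodule R M}
    (hD : DirectSum.IsInternal D) (e : M ≃ₗ[R] N) :
    DirectSum.IsInternal fun i => (D i).map e.toLinearMap :=
  DirectSum.isInternal_submodule_of_iSupIndep_of_iSup_eq_top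
    (e.toLinearMap.iSupIndep_map e.injective hD.submodule_iSupIndep)
    (by rw [← Submodule.map_iSup, hD.submodule_iSup_eq_top, Submodule.map_top, e.range])

variable {R A P : Type*} [CommRing R] [Ring A] [Algebra R A] [AddCommGroup P] [Module R P]
  [Module A P] [IsScalarTower R A P]

theorem top_smul_eq_top_of_span_eq_top {V : Submodule R P}
    (hV : Submodule.span A (V : Set P) = ⊤) : (⊤ : Submodule R A) • V = ⊤ := by
  refine Submodule.eq_top_iff'.2 fun x => ?_
  induction (hV ▸ Submodule.mem_top : x ∈ Submodule.span A (V : Set P)) using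
    Submodule.closure_induction with
  | zero => exact zero_mem _
  | add x y _ _ hx hy => exact add_mem hx hy
  | smul_mem a v hv => exact Submodule.smul_mem_smul Submodule.mem_top hv

theorem eq_iSup_smul_of_span_eq_top {ι : Type*} [DecidableEq ι] [Add ι] {𝒞 : ι → Submodule R A}
    [DirectSum.Decomposition 𝒞] {D : ι → Submodule R P} (hD : DirectSum.IsInternal D)
    (hsmul : ∀ i j, 𝒞 i • D j ≤ D (i + j)) {n : ι}
    (hn : Submodule.span A (D n : Set P) = ⊤) (j : ι) :
    D j = ⨆ (i) (_ : i + n = j), 𝒞 i • D n := by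
  have htop : ⨆ (j) (i) (_ : i + n = j), 𝒞 i • D n = ⊤ := by
    rw [← top_smul_eq_top_of_span_eq_top hn,
      ← (DirectSum.Decomposition.isInternal 𝒞).submodule_iSup_eq_top, Submodule.iSup_smul,
      iSup_comm]
    simp only [iSup_iSup_eq_right]
  rw [← inf_iSup_eq_of_iSupIndep_of_le hD.submodule_iSupIndep
    (s := fun j => ⨆ (i) (_ : i + n = j), 𝒞 i • D n)
    (fun j => iSup₂_le fun i hi => hi ▸ hsmul i n) j, htop, inf_top_eq]

variable {𝒞 : ℕ → Submodule R A} [DirectSum.Decomposition 𝒞] {D : ℕ → Submodule R P}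

theorem deg_add_eq_smul_of_span_eq_top (hD : DirectSum.IsInternal D)
    (hsmul : ∀ i j, 𝒞 i • D j ≤ D (i + j)) {n : ℕ}
    (hn : Submodule.span A (D n : Set P) = ⊤) (m : ℕ) : D (m + n) = 𝒞 m • D n := by
  simp only [eq_iSup_smul_of_span_eq_top hD hsmul hn (m + n), add_left_inj, iSup_iSup_eq_left]

theorem deg_eq_bot_of_lt_of_span_eq_top (hD : DirectSum.IsInternal D)
    (hsmul : ∀ i j, 𝒞 i • D j ≤ D (i + j)) {n : ℕ}
    (hn : Submodule.span A (D n : Set P) = ⊤) {j : ℕ} (hj : j < n) : D j = ⊥ := by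
  rw [eq_iSup_smul_of_span_eq_top hD hsmul hn j]
  exact iSup₂_eq_bot.2 fun i hi => by omega

end GradedModule

section InducedModule

variable {R A V P : Type*} [CommRing R] [Ring A] [Algebra R A] [AddCommGroup V] [Module R V]
  [AddCommGroup P] [Module R P] [Module A P] [IsScalarTower R A P]

variable (A) in
/-- The `A`-linear map `a ⊗ v ↦ a • k v` extending an `R`-linear map `k` to the induced module
`A ⊗ V`; unlike `LinearMap.liftBaseChange`, it does not require `A` to be commutative. -/
def inducedLift (k : V →ₗ[R] P) : A ⊗[R] V →ₗ[A] P :=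
  TensorProduct.AlgebraTensorModule.lift (LinearMap.toSpanSingleton A (V →ₗ[R] P) k)

@[simp]
theorem inducedLift_tmul (k : V →ₗ[R] P) (a : A) (v : V) :
    inducedLift A k (a ⊗ₜ v) = a • k v := rfl

theorem inducedLift_restrictScalars_comp {Q : Type*} [AddCommGroup Q] [Module R Q] [Module A Q]
    [IsScalarTower R A Q] (g : P →ₗ[A] Q) (k : V →ₗ[R] P) (x : A ⊗[R] V) :
    inducedLift A (g.restrictScalars R ∘ₗ k) x = g (inducedLift A k x) := by
  induction x with
  | zero => simp only [map_zero]
  | add x y hx hy => simp only [map_add, hx, hy]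
  | tmul a v => exact (map_smul g a (k v)).symm

theorem inducedLift_surjective {k : V →ₗ[R] P}
    (hk : Submodule.span A (LinearMap.range k : Set P) = ⊤) :
    Function.Surjective (inducedLift A k) := by
  rw [← LinearMap.range_eq_top, ← top_le_iff, ← hk, Submodule.span_le]
  rintro _ ⟨v, rfl⟩
  exact ⟨1 ⊗ₜ v, one_smul A (k v)⟩

@[elab_as_elim]
theorem inducedModule_induction {ι : Type*} [DecidableEq ι] (𝒟 : ι → Submodule R A)
    [DirectSum.Decomposition 𝒟] {p : A ⊗[R] V → Prop} (zero : p 0)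
    (tmul : ∀ i, ∀ a ∈ 𝒟 i, ∀ v : V, p (a ⊗ₜ v))
    (add : ∀ x y, p x → p y → p (x + y)) (x : A ⊗[R] V) : p x := by
  induction x with
  | zero => exact zero
  | add x y hx hy => exact add x y hx hy
  | tmul a v =>
    induction a using DirectSum.Decomposition.inductionOn 𝒟 with
    | zero => rwa [TensorProduct.zero_tmul]
    | homogeneous a => exact tmul _ a a.2 v
    | add a b ha hb => rw [TensorProduct.add_tmul]; exact add _ _ ha hb

variable (𝒞 : ℕ → Submodule R A) [GradedAlgebra 𝒞]

variable (V) in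
/-- The projection of the induced module `A ⊗ V` onto its component `𝒞 n ⊗ V`. -/
def inducedProj (n : ℕ) : A ⊗[R] V →ₗ[R] A ⊗[R] V :=
  (GradedAlgebra.proj 𝒞 n).rTensor V

theorem inducedProj_tmul (n : ℕ) (a : A) (v : V) :
    inducedProj V 𝒞 n (a ⊗ₜ v) = (DirectSum.decompose 𝒞 a n : A) ⊗ₜ v := rfl

theorem inducedProj_tmul_of_mem {m : ℕ} {a : A} (ha : a ∈ 𝒞 m) (n : ℕ) (v : V) :
    inducedProj V 𝒞 n (a ⊗ₜ v) = if m = n then a ⊗ₜ v else 0 := by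
  split_ifs with h
  · rw [inducedProj_tmul, DirectSum.decompose_of_mem_same 𝒞 (h ▸ ha)]
  · rw [inducedProj_tmul, DirectSum.decompose_of_mem_ne 𝒞 ha h, TensorProduct.zero_tmul]

theorem inducedProj_add_smul {m : ℕ} {a : A} (ha : a ∈ 𝒞 m) (n : ℕ) (x : A ⊗[R] V) :
    inducedProj V 𝒞 (m + n) (a • x) = a • inducedProj V 𝒞 n x := by
  induction x with
  | zero => simp only [smul_zero, map_zero]
  | add x y hx hy => simp only [smul_add, map_add, hx, hy]
  | tmul b v =>
    simp only [TensorProduct.smul_tmul', smul_eq_mul, inducedProj_tmul,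
      DirectSum.coe_decompose_mul_add_of_left_mem 𝒞 ha]

theorem inducedProj_smul_of_lt {m n : ℕ} (hmn : n < m) {a : A} (ha : a ∈ 𝒞 m) (x : A ⊗[R] V) :
    inducedProj V 𝒞 n (a • x) = 0 := by
  induction x with
  | zero => simp only [smul_zero, map_zero]
  | add x y hx hy => simp only [smul_add, map_add, hx, hy, add_zero]
  | tmul b v =>
    rw [TensorProduct.smul_tmul', smul_eq_mul, inducedProj_tmul,
      DirectSum.coe_decompose_mul_of_left_mem_of_not_le 𝒞 ha hmn.not_ge, TensorProduct.zero_tmul]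

theorem eq_zero_of_forall_inducedProj_eq_zero {x : A ⊗[R] V}
    (hx : ∀ n, inducedProj V 𝒞 n x = 0) : x = 0 := by
  have hsum : ∃ N, ∀ M ≥ N, ∑ n ∈ Finset.range M, inducedProj V 𝒞 n x = x := by
    clear hx
    induction x using inducedModule_induction 𝒞 with
    | zero => simp
    | add x y hx hy =>
      obtain ⟨M, hM⟩ := hx
      obtain ⟨N, hN⟩ := hy
      refine ⟨max M N, fun L hL => ?_⟩
      simp only [map_add, Finset.sum_add_distrib, hM L (le_of_max_le_left hL),
        hN L (le_of_max_le_right hL)]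
    | tmul m a ha v =>
      refine ⟨m + 1, fun M hM => ?_⟩
      simp only [inducedProj_tmul_of_mem 𝒞 ha, Finset.sum_ite_eq, Finset.mem_range,
        Nat.lt_of_succ_le hM, if_true]
  obtain ⟨N, hN⟩ := hsum
  rw [← hN N le_rfl, Finset.sum_eq_zero fun n _ => hx n]

theorem inducedProj_apply_eq_sum {f : A ⊗[R] V →ₗ[A] A ⊗[R] V}
    (hf : ∀ x, inducedProj V 𝒞 0 (f x) = 0) (n : ℕ) (x : A ⊗[R] V) :
    inducedProj V 𝒞 n (f x) =
      ∑ i ∈ Finset.range n, inducedProj V 𝒞 n (f (inducedProj V 𝒞 i x)) := by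
  induction x using inducedModule_induction 𝒞 with
  | zero => simp
  | add x y hx hy => simp only [map_add, Finset.sum_add_distrib, hx, hy]
  | tmul m a ha v =>
    have hzero : n ≤ m → inducedProj V 𝒞 n (f (a ⊗ₜ v)) = 0 := by
      rw [← mul_one a, ← smul_eq_mul, ← TensorProduct.smul_tmul', map_smul]
      intro hnm
      obtain rfl | hlt := hnm.eq_or_lt
      · simpa [hf] using inducedProj_add_smul 𝒞 ha 0 (f (1 ⊗ₜ v))
      · exact inducedProj_smul_of_lt 𝒞 hlt ha _
    simp only [inducedProj_tmul_of_mem 𝒞 ha, apply_ite, map_zero, Finset.sum_ite_eq,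
      Finset.mem_range]
    split_ifs with hmn
    exact hzero (not_lt.1 hmn)

-- `f` raises degrees, so the fixed vector `x = f x` has no component of lowest degree.
theorem eq_zero_of_map_eq_self {f : A ⊗[R] V →ₗ[A] A ⊗[R] V}
    (hf : ∀ x, inducedProj V 𝒞 0 (f x) = 0) {x : A ⊗[R] V} (hx : f x = x) : x = 0 := by
  refine eq_zero_of_forall_inducedProj_eq_zero 𝒞 fun n => ?_
  induction n using Nat.strong_induction_on with
  | _ n ih =>
    rw [← hx, inducedProj_apply_eq_sum 𝒞 hf]
    refine Finset.sum_eq_zero fun i hi => ?_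
    rw [ih i (Finset.mem_range.1 hi), map_zero, map_zero]

variable {𝒞}

theorem inducedProj_zero_eq_one_tmul (h𝒞 : 𝒞 0 ≤ 1) {k : V →ₗ[R] P} {q : P →ₗ[R] V}
    (hqk : ∀ v, q (k v) = v) (hq : ∀ m ≠ 0, ∀ a ∈ 𝒞 m, ∀ v, q (a • k v) = 0) (x : A ⊗[R] V) :
    inducedProj V 𝒞 0 x = 1 ⊗ₜ q (inducedLift A k x) := by
  induction x using inducedModule_induction 𝒞 with
  | zero => simp
  | add x y hx hy => simp only [map_add, TensorProduct.tmul_add, hx, hy]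
  | tmul m a ha v =>
    rw [inducedProj_tmul_of_mem 𝒞 ha, inducedLift_tmul]
    split_ifs with hm
    · obtain ⟨r, rfl⟩ := Submodule.mem_one.1 (h𝒞 (hm ▸ ha))
      rw [algebraMap_smul, map_smul, hqk, Algebra.algebraMap_eq_smul_one,
        TensorProduct.smul_tmul]
    · rw [hq m hm a ha, TensorProduct.tmul_zero]

theorem inducedLift_bijective [Module.Projective A P] (h𝒞 : 𝒞 0 ≤ 1) {k : V →ₗ[R] P}
    (hk : Submodule.span A (LinearMap.range k : Set P) = ⊤) {q : P →ₗ[R] V}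
    (hqk : ∀ v, q (k v) = v) (hq : ∀ m ≠ 0, ∀ a ∈ 𝒞 m, ∀ v, q (a • k v) = 0) :
    Function.Bijective (inducedLift A k) := by
  have hsurj := inducedLift_surjective hk
  obtain ⟨s, hs⟩ := Module.projective_lifting_property (inducedLift A k) LinearMap.id hsurj
  refine ⟨(injective_iff_map_eq_zero _).2 fun x hx => ?_, hsurj⟩
  refine eq_zero_of_map_eq_self 𝒞 (f := LinearMap.id - s ∘ₗ inducedLift A k) (fun y => ?_) ?_
  · have hy : inducedLift A k (s (inducedLift A k y)) = inducedLift A k y :=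
      LinearMap.congr_fun hs _
    rw [inducedProj_zero_eq_one_tmul h𝒞 hqk hq]
    simp [hy]
  · simp [hx]

theorem inducedLift_subtype_bijective [Module.Projective A P] (h𝒞 : 𝒞 0 ≤ 1)
    {D : ℕ → Submodule R P} (hD : DirectSum.IsInternal D)
    (hsmul : ∀ i j, 𝒞 i • D j ≤ D (i + j)) {n : ℕ}
    (hn : Submodule.span A (D n : Set P) = ⊤) :
    Function.Bijective (inducedLift A (D n).subtype) := by
  let _ := hD.chooseDecomposition
  refine inducedLift_bijective h𝒞 (by simpa using hn)
    (q := DirectSum.component R ℕ (fun i => D i) n ∘ₗ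
      (DirectSum.decomposeLinearEquiv D).toLinearMap) (fun v => ?_) fun m hm a ha v => ?_
  · simp
  · have hav : a • (v : P) ∈ D (m + n) := hsmul m n (Submodule.smul_mem_smul ha v.2)
    exact Subtype.ext (DirectSum.decompose_of_mem_ne D hav (by omega))

end InducedModule

section Connected

variable {R A : Type*} [CommRing R] [Ring A] [Algebra R A] (𝒞 : ℕ → Submodule R A)
  [GradedAlgebra 𝒞]

theorem zero_le_one_of_adjoin_eq_top (h𝒞 : Algebra.adjoin R (𝒞 1 : Set A) = ⊤) : 𝒞 0 ≤ 1 := by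
  have hproj : ∀ a ∈ Algebra.adjoin R (𝒞 1 : Set A),
      GradedRing.projZeroRingHom 𝒞 a ∈ (⊥ : Subalgebra R A) := by
    intro a ha
    induction ha using Algebra.adjoin_induction with
    | mem x hx =>
      rw [GradedRing.projZeroRingHom_apply, DirectSum.decompose_of_mem_ne 𝒞 hx one_ne_zero]
      exact zero_mem _
    | algebraMap r =>
      rw [GradedRing.projZeroRingHom_apply,
        DirectSum.decompose_of_mem_same 𝒞 (SetLike.algebraMap_mem_graded 𝒞 r)]
      exact Subalgebra.algebraMap_mem _ r
    | add x y _ _ hx hy => rw [map_add]; exact add_mem hx hy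
    | mul x y _ _ hx hy => rw [map_mul]; exact mul_mem hx hy
  intro a ha
  have hbot := hproj a (h𝒞 ▸ Algebra.mem_top)
  rw [GradedRing.projZeroRingHom_apply, DirectSum.decompose_of_mem_same 𝒞 ha] at hbot
  exact Submodule.mem_one.2 (Algebra.mem_bot.1 hbot)

theorem isSemisimpleRing_zero_of_le_one [IsSemisimpleRing R] (h𝒞 : 𝒞 0 ≤ 1) :
    IsSemisimpleRing (𝒞 0) :=
  RingHom.isSemisimpleRing_of_surjective (algebraMap R (𝒞 0)) fun a => by
    obtain ⟨r, hr⟩ := Submodule.mem_one.1 (h𝒞 a.2)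
    exact ⟨r, Subtype.ext hr⟩

end Connected

theorem exists_linearEquiv_of_range_eq {R V N : Type*} [Ring R] [AddCommGroup V] [Module R V]
    [AddCommGroup N] [Module R N] {k k' : V →ₗ[R] N} (hk : Function.Injective k)
    (hk' : Function.Injective k') (h : LinearMap.range k = LinearMap.range k') :
    ∃ ψ : V ≃ₗ[R] V, ∀ v, k (ψ v) = k' v := by
  refine ⟨LinearEquiv.ofInjective k' hk' ≪≫ₗ LinearEquiv.ofEq _ _ h.symm ≪≫ₗ
    (LinearEquiv.ofInjective k hk).symm, fun v => ?_⟩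
  exact congrArg Subtype.val (LinearEquiv.apply_symm_apply (LinearEquiv.ofInjective k hk)
    ⟨k' v, h ▸ LinearMap.mem_range_self k' v⟩)

section ZhangEquiv

variable {R A B Γ : Type*} [CommRing R] [Ring A] [Algebra R A] [Ring B] [Algebra R B]

/-- A Zhang twist relating two `Γ`-graded algebras: a family of graded linear equivalences `t γ`
such that `t γ (a * b) = t γ a * t (γ + δ) b` for `a` of degree `δ`. In contrast to a presentation
of one algebra as a twist of the other, this notion is symmetric. -/
structure ZhangEquiv [Add Γ] (𝒜 : Γ → Submodule R A) (ℬ : Γ → Submodule R B) where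
  /-- The linear equivalence attached to an element of the monoid. -/
  toEquiv : Γ → A ≃ₗ[R] B
  map_deg : ∀ γ δ, (𝒜 δ).map (toEquiv γ).toLinearMap = ℬ δ
  map_mul_of_mem : ∀ (γ : Γ) {δ : Γ} {a : A}, a ∈ 𝒜 δ →
    ∀ b, toEquiv γ (a * b) = toEquiv γ a * toEquiv (γ + δ) b

namespace ZhangEquiv

section Add

variable [Add Γ] {𝒜 : Γ → Submodule R A} {ℬ : Γ → Submodule R B}

instance : CoeFun (ZhangEquiv 𝒜 ℬ) fun _ => Γ → A ≃ₗ[R] B := ⟨toEquiv⟩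

variable (T : ZhangEquiv 𝒜 ℬ)

theorem apply_mem_iff (γ : Γ) {δ : Γ} {a : A} : T γ a ∈ ℬ δ ↔ a ∈ 𝒜 δ := by
  rw [← T.map_deg γ δ]
  exact (T γ).injective.mem_set_image

/-- The inverse Zhang twist. -/
def symm : ZhangEquiv ℬ 𝒜 where
  toEquiv γ := (T γ).symm
  map_deg γ δ := (Submodule.map_symm_eq_iff (T γ)).2 (T.map_deg γ δ)
  map_mul_of_mem γ δ b hb b' := by
    have hb' : (T γ).symm b ∈ 𝒜 δ := (T.apply_mem_iff γ).1 (by simpa using hb)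
    rw [LinearEquiv.symm_apply_eq, T.map_mul_of_mem γ hb', LinearEquiv.apply_symm_apply,
      LinearEquiv.apply_symm_apply]

/-- A family of linear equivalences `φ γ` from an `A`-module to a `B`-module that is compatible
with the Zhang twist `T` relating `A` and `B`, namely `φ γ (a • m) = T γ a • φ (γ + δ) m` for `a` of
degree `δ`. -/
structure ModuleEquiv (M N : Type*) [AddCommGroup M] [Module R M] [Module A M] [AddCommGroup N]
    [Module R N] [Module B N] where
  /-- The linear equivalence attached to an element of the monoid. -/
  toEquiv : Γ → M ≃ₗ[R] N
  map_smul_of_mem : ∀ (γ : Γ) {δ : Γ} {a : A}, a ∈ 𝒜 δ →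
    ∀ m, toEquiv γ (a • m) = T γ a • toEquiv (γ + δ) m

namespace ModuleEquiv

variable {T} {M N : Type*} [AddCommGroup M] [Module R M] [Module A M] [AddCommGroup N]
  [Module R N] [Module B N]

instance : CoeFun (T.ModuleEquiv M N) fun _ => Γ → M ≃ₗ[R] N := ⟨toEquiv⟩

/-- Precomposition with an isomorphism of `A`-modules. -/
def precomp {P : Type*} [AddCommGroup P] [Module R P] [Module A P] [IsScalarTower R A M]
    [IsScalarTower R A P] (Φ : T.ModuleEquiv M N) (e : P ≃ₗ[A] M) : T.ModuleEquiv P N where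
  toEquiv γ := e.restrictScalars R ≪≫ₗ Φ γ
  map_smul_of_mem γ δ a ha p := by
    simp [Φ.map_smul_of_mem γ ha]

theorem map_deg_smul [IsScalarTower R A M] [IsScalarTower R B N] (Φ : T.ModuleEquiv M N)
    (γ δ : Γ) (U : Submodule R M) :
    (𝒜 δ • U).map (Φ γ).toLinearMap = ℬ δ • U.map (Φ (γ + δ)).toLinearMap := by
  apply le_antisymm
  · rw [Submodule.map_le_iff_le_comap, Submodule.smul_le]
    intro a ha m hm
    rw [Submodule.mem_comap, LinearEquiv.coe_coe, Φ.map_smul_of_mem γ ha]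
    exact Submodule.smul_mem_smul ((T.apply_mem_iff γ).2 ha) (Submodule.mem_map_of_mem hm)
  · rw [Submodule.smul_le, ← T.map_deg γ δ]
    rintro _ ⟨a, ha, rfl⟩ _ ⟨m, hm, rfl⟩
    exact ⟨a • m, Submodule.smul_mem_smul ha hm, Φ.map_smul_of_mem γ ha m⟩

end ModuleEquiv

end Add

variable [AddMonoid Γ] {𝒜 : Γ → Submodule R A} {ℬ : Γ → Submodule R B} (T : ZhangEquiv 𝒜 ℬ)

theorem map_one [SetLike.GradedOne 𝒜] (γ : Γ) : T γ 1 = 1 := by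
  have h := T.map_mul_of_mem γ SetLike.GradedOne.one_mem ((T γ).symm 1)
  rwa [one_mul, add_zero, LinearEquiv.apply_symm_apply, mul_one, eq_comm] at h

namespace ModuleEquiv

variable {T} {M N : Type*} [AddCommGroup M] [Module R M] [Module A M]
  [AddCommGroup N] [Module R N] [Module B N] (Φ : T.ModuleEquiv M N)

/-- A subspace of `M` is stable under the family `Φ` if its image under `Φ γ` does not depend on
`γ`. -/
def IsStable (U : Submodule R M) : Prop :=
  ∀ γ, U.map (Φ γ).toLinearMap = U.map (Φ 0).toLinearMap

variable {Φ}

theorem isStable_top : Φ.IsStable ⊤ := fun γ => by simp only [Submodule.map_top, LinearEquiv.range]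

theorem IsStable.inf {U V : Submodule R M} (hU : Φ.IsStable U) (hV : Φ.IsStable V) :
    Φ.IsStable (U ⊓ V) := fun γ => by
  rw [Submodule.map_inf _ (Φ γ).injective, Submodule.map_inf _ (Φ 0).injective, hU γ, hV γ]

theorem isStable_ker {M' N' : Type*} [AddCommGroup M'] [Module R M'] [Module A M']
    [AddCommGroup N'] [Module R N'] [Module B N'] {Φ' : T.ModuleEquiv M' N'} {g : M →ₗ[R] M'}
    {f : N →ₗ[R] N'} (h : ∀ γ x, f (Φ γ x) = Φ' γ (g x)) : Φ.IsStable (LinearMap.ker g) := by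
  have hmap : ∀ γ, (LinearMap.ker g).map (Φ γ).toLinearMap = LinearMap.ker f := fun γ => by
    ext y
    obtain ⟨x, rfl⟩ := (Φ γ).surjective y
    rw [LinearMap.mem_ker, h]
    refine (Φ γ).injective.mem_set_image.trans ?_
    simp
  exact fun γ => (hmap γ).trans (hmap 0).symm

end ModuleEquiv

section Free

variable [DecidableEq Γ] [GradedAlgebra 𝒜] [GradedAlgebra ℬ] {V W : Type*} [AddCommGroup V]
  [Module R V] [AddCommGroup W] [Module R W]

/-- The linear equivalence `a ⊗ v ↦ T γ a ⊗ ψ (γ + δ) v` for `a` of degree `δ`. -/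
def inducedEquiv (ψ : Γ → V ≃ₗ[R] W) (γ : Γ) : A ⊗[R] V ≃ₗ[R] B ⊗[R] W :=
  (TensorProduct.congr (DirectSum.decomposeLinearEquiv 𝒜) (LinearEquiv.refl R V)) ≪≫ₗ
    TensorProduct.directSumLeft R R (fun δ => 𝒜 δ) V ≪≫ₗ
    DirectSum.congrLinearEquiv (fun δ =>
      TensorProduct.congr ((T γ).ofSubmodules (𝒜 δ) (ℬ δ) (T.map_deg γ δ)) (ψ (γ + δ))) ≪≫ₗ
    (TensorProduct.directSumLeft R R (fun δ => ℬ δ) W).symm ≪≫ₗ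
    (TensorProduct.congr (DirectSum.decomposeLinearEquiv ℬ) (LinearEquiv.refl R W)).symm

theorem inducedEquiv_tmul (ψ : Γ → V ≃ₗ[R] W) (γ : Γ) {δ : Γ} {a : A} (ha : a ∈ 𝒜 δ) (v : V) :
    T.inducedEquiv ψ γ (a ⊗ₜ v) = T γ a ⊗ₜ ψ (γ + δ) v := by
  lift a to 𝒜 δ using ha
  have hTa : T γ a = ((T γ).ofSubmodules (𝒜 δ) (ℬ δ) (T.map_deg γ δ) a : B) := rfl
  simp only [inducedEquiv, LinearEquiv.trans_apply, LinearEquiv.symm_apply_eq,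
    TensorProduct.congr_tmul, LinearEquiv.refl_apply, DirectSum.decomposeLinearEquiv_apply, hTa,
    DirectSum.decompose_coe, ← DirectSum.lof_eq_of R, TensorProduct.directSumLeft_tmul_lof,
    DirectSum.coe_congrLinearEquiv, DirectSum.lmap_lof, LinearEquiv.coe_coe]

/-- The compatible family `a ⊗ v ↦ T γ a ⊗ ψ (γ + δ) v`, for `a` of degree `δ`, between induced
modules. -/
def inducedModuleEquiv (ψ : Γ → V ≃ₗ[R] W) : T.ModuleEquiv (A ⊗[R] V) (B ⊗[R] W) where
  toEquiv := T.inducedEquiv ψ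
  map_smul_of_mem γ δ a ha x := by
    induction x using inducedModule_induction 𝒜 with
    | zero => simp only [smul_zero, map_zero]
    | add x y hx hy => simp only [smul_add, map_add, hx, hy]
    | tmul ε b hb v =>
      rw [TensorProduct.smul_tmul', smul_eq_mul,
        T.inducedEquiv_tmul ψ γ (SetLike.mul_mem_graded ha hb), T.inducedEquiv_tmul ψ (γ + δ) hb,
        TensorProduct.smul_tmul', smul_eq_mul, T.map_mul_of_mem γ ha, add_assoc]

theorem inducedModuleEquiv_tmul (ψ : Γ → V ≃ₗ[R] W) (γ : Γ) {δ : Γ} {a : A} (ha : a ∈ 𝒜 δ)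
    (v : V) : T.inducedModuleEquiv ψ γ (a ⊗ₜ v) = T γ a ⊗ₜ ψ (γ + δ) v :=
  T.inducedEquiv_tmul ψ γ ha v

theorem map_inducedModuleEquiv_range_mk_one (ψ : Γ → V ≃ₗ[R] W) (γ : Γ) :
    (LinearMap.range (TensorProduct.mk R A V 1)).map (T.inducedModuleEquiv ψ γ).toLinearMap =
      LinearMap.range (TensorProduct.mk R B W 1) := by
  have hcomp : (T.inducedModuleEquiv ψ γ).toLinearMap ∘ₗ TensorProduct.mk R A V 1 =
      TensorProduct.mk R B W 1 ∘ₗ (ψ γ).toLinearMap := by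
    ext v
    simpa [T.map_one] using T.inducedModuleEquiv_tmul ψ γ (SetLike.GradedOne.one_mem (A := 𝒜)) v
  rw [← LinearMap.range_comp, hcomp, LinearEquiv.range_comp]

theorem ModuleEquiv.exists_lift {T : ZhangEquiv 𝒜 ℬ} {M N : Type*} [AddCommGroup M] [Module R M]
    [Module A M] [IsScalarTower R A M] [AddCommGroup N] [Module R N] [Module B N]
    [IsScalarTower R B N] (Φ : T.ModuleEquiv M N) {k : V →ₗ[R] M} (hk : Function.Injective k)
    (hstable : Φ.IsStable (LinearMap.range k)) :
    ∃ ψ : Γ → V ≃ₗ[R] V, ∀ γ x,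
      inducedLift B ((Φ 0).toLinearMap ∘ₗ k) (T.inducedModuleEquiv ψ γ x) =
        Φ γ (inducedLift A k x) := by
  have hψ : ∀ γ, ∃ ψ : V ≃ₗ[R] V, ∀ v, Φ 0 (k (ψ v)) = Φ γ (k v) := fun γ =>
    exists_linearEquiv_of_range_eq (k := (Φ 0).toLinearMap ∘ₗ k) (k' := (Φ γ).toLinearMap ∘ₗ k)
      ((Φ 0).injective.comp hk) ((Φ γ).injective.comp hk)
      (by rw [LinearMap.range_comp, LinearMap.range_comp, hstable γ])
  choose ψ hψ using hψ
  refine ⟨ψ, fun γ x => ?_⟩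
  induction x using inducedModule_induction 𝒜 with
  | zero => simp only [map_zero]
  | add x y hx hy => simp only [map_add, hx, hy]
  | tmul δ a ha v =>
    rw [T.inducedModuleEquiv_tmul ψ γ ha, inducedLift_tmul, inducedLift_tmul,
      Φ.map_smul_of_mem γ ha, ← hψ (γ + δ) v, LinearMap.comp_apply, LinearEquiv.coe_coe]

end Free

end ZhangEquiv

end ZhangEquiv

section Coarsen

variable {Γ A B : Type*} [AddMonoid Γ] [Ring A] [Algebra ℂ A] [Ring B] [Algebra ℂ B]
  {𝒜 : Γ → Submodule ℂ A} {ℬ : Γ → Submodule ℂ B} {T : ZhangEquiv 𝒜 ℬ}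

namespace ZhangEquiv

theorem map_coarsen (T : ZhangEquiv 𝒜 ℬ) (h : Γ →+ ℕ) (γ : Γ) (n : ℕ) :
    (coarsen 𝒜 h n).map (T γ).toLinearMap = coarsen ℬ h n := by
  simp only [coarsen, Submodule.map_iSup, T.map_deg]

theorem coarsen_zero_le_one [SetLike.GradedOne 𝒜] (T : ZhangEquiv 𝒜 ℬ) {h : Γ →+ ℕ}
    (h𝒜 : coarsen 𝒜 h 0 ≤ 1) : coarsen ℬ h 0 ≤ 1 := by
  rw [← T.map_coarsen h 0, Submodule.map_le_iff_le_comap]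
  refine h𝒜.trans ?_
  rw [Submodule.one_le, Submodule.mem_comap, LinearEquiv.coe_coe, T.map_one]
  exact Submodule.one_le.1 le_rfl

theorem ModuleEquiv.IsStable.map_coarsen_smul {M N : Type*} [AddCommGroup M] [Module ℂ M]
    [Module A M] [IsScalarTower ℂ A M] [AddCommGroup N] [Module ℂ N] [Module B N]
    [IsScalarTower ℂ B N] {Φ : T.ModuleEquiv M N} {U : Submodule ℂ M} (hU : Φ.IsStable U)
    (h : Γ →+ ℕ) (n : ℕ) (γ : Γ) :
    (coarsen 𝒜 h n • U).map (Φ γ).toLinearMap = coarsen ℬ h n • U.map (Φ 0).toLinearMap := by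
  simp only [coarsen, Submodule.iSup_smul, Submodule.map_iSup, Φ.map_deg_smul, hU _]

/-- The compatible family between cyclic modules induced by the Zhang twist itself. -/
def quotientModuleEquiv (T : ZhangEquiv 𝒜 ℬ) {I : Ideal A} {J : Ideal B}
    (hIJ : ∀ γ, (I.restrictScalars ℂ).map (T γ).toLinearMap = J.restrictScalars ℂ) :
    T.ModuleEquiv (A ⧸ I) (B ⧸ J) where
  toEquiv γ := (Submodule.Quotient.restrictScalarsEquiv ℂ I).symm ≪≫ₗ
    Submodule.Quotient.equiv _ _ (T γ) (hIJ γ) ≪≫ₗ Submodule.Quotient.restrictScalarsEquiv ℂ J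
  map_smul_of_mem γ δ a ha x := by
    obtain ⟨x, rfl⟩ := Submodule.Quotient.mk_surjective I x
    exact congrArg (Submodule.Quotient.mk (p := J)) (T.map_mul_of_mem γ ha x)

end ZhangEquiv

theorem restrictScalars_irrelevant_eq_iSup {R A : Type*} [CommRing R] [Ring A] [Algebra R A]
    (𝒞 : ℕ → Submodule R A) [GradedAlgebra 𝒞] :
    (HomogeneousIdeal.irrelevant 𝒞).toIdeal.restrictScalars R = ⨆ i > 0, 𝒞 i := by
  apply Submodule.toAddSubmonoid_injective
  simp only [Submodule.iSup_toAddSubmonoid]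
  exact HomogeneousIdeal.irrelevant_eq_iSup 𝒞

theorem ZhangEquiv.map_irrelevant_coarsen [DecidableEq Γ] [GradedAlgebra 𝒜] [GradedAlgebra ℬ]
    (T : ZhangEquiv 𝒜 ℬ) (h : Γ →+ ℕ) (γ : Γ) :
    ((HomogeneousIdeal.irrelevant (coarsen 𝒜 h)).toIdeal.restrictScalars ℂ).map
      (T γ).toLinearMap =
      (HomogeneousIdeal.irrelevant (coarsen ℬ h)).toIdeal.restrictScalars ℂ := by
  simp only [restrictScalars_irrelevant_eq_iSup, Submodule.map_iSup, T.map_coarsen]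

end Coarsen

namespace LinearResolution

section Components

variable {A : Type u} [Ring A] [Algebra ℂ A] {𝒞 : ℕ → Submodule ℂ A} [GradedAlgebra 𝒞]
  (Res : LinearResolution 𝒞)

attribute [local instance] addCommGroup moduleComplex module isScalarTower projective

theorem smul_deg_le (i m n : ℕ) : 𝒞 m • Res.deg i n ≤ Res.deg i (m + n) :=
  Submodule.smul_le.2 fun a ha x hx => Res.smul_mem i m n a x ha hx

theorem deg_add_eq_smul (i m : ℕ) : Res.deg i (m + i) = 𝒞 m • Res.deg i i :=
  deg_add_eq_smul_of_span_eq_top (Res.isInternal i) (Res.smul_deg_le i) (Res.generated i) m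

theorem deg_eq_bot_of_lt {i j : ℕ} (hij : j < i) : Res.deg i j = ⊥ :=
  deg_eq_bot_of_lt_of_span_eq_top (Res.isInternal i) (Res.smul_deg_le i) (Res.generated i) hij

theorem map_d_deg (i j : ℕ) : (Res.deg (i + 1) j).map ((Res.d i).restrictScalars ℂ) =
    Res.deg i j ⊓ LinearMap.range ((Res.d i).restrictScalars ℂ) :=
  map_eq_inf_range_of_isInternal (Res.isInternal (i + 1)) (Res.isInternal i)
    (f := (Res.d i).restrictScalars ℂ)
    (fun j => Submodule.map_le_iff_le_comap.2 (Res.d_mem i j)) j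

theorem disjoint_deg_range_d (i : ℕ) :
    Disjoint (Res.deg i i) (LinearMap.range ((Res.d i).restrictScalars ℂ)) := by
  rw [disjoint_iff, ← Res.map_d_deg, Res.deg_eq_bot_of_lt i.lt_succ_self, Submodule.map_bot]

theorem map_ε_deg : (Res.deg 0 0).map (Res.ε.restrictScalars ℂ) = ⊤ := by
  have hε : ∀ j ≠ 0, (Res.deg 0 j).map (Res.ε.restrictScalars ℂ) = ⊥ := fun j hj =>
    eq_bot_iff.2 <| Submodule.map_le_iff_le_comap.2 fun x hx =>
      (Submodule.mem_bot ℂ).2 (Res.ε_eq_zero j x hj hx)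
  have hrange : LinearMap.range (Res.ε.restrictScalars ℂ) = ⊤ :=
    LinearMap.range_eq_top.2 Res.surjective_ε
  rw [← hrange, LinearMap.range_eq_map, ← (Res.isInternal 0).submodule_iSup_eq_top,
    Submodule.map_iSup, iSup_split_single _ 0, iSup₂_eq_bot.2 hε, sup_bot_eq]

/-- The isomorphism of the `i`-th term with the module induced from its component of degree `i`. -/
def inducedEquiv (h𝒞 : 𝒞 0 ≤ 1) (i : ℕ) : A ⊗[ℂ] Res.deg i i ≃ₗ[A] Res.P i :=
  LinearEquiv.ofBijective (inducedLift A (Res.deg i i).subtype)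
    (inducedLift_subtype_bijective h𝒞 (Res.isInternal i) (Res.smul_deg_le i) (Res.generated i))

theorem map_inducedEquiv_range_mk_one (h𝒞 : 𝒞 0 ≤ 1) (i : ℕ) :
    (LinearMap.range (TensorProduct.mk ℂ A (Res.deg i i) 1)).map
      ((Res.inducedEquiv h𝒞 i).restrictScalars ℂ).toLinearMap = Res.deg i i := by
  have hcomp : ((Res.inducedEquiv h𝒞 i).restrictScalars ℂ).toLinearMap ∘ₗ
      TensorProduct.mk ℂ A (Res.deg i i) 1 = (Res.deg i i).subtype :=
    LinearMap.ext fun v => one_smul A (v : Res.P i)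
  rw [← LinearMap.range_comp, hcomp, Submodule.range_subtype]

end Components

section Lift

attribute [local instance] addCommGroup moduleComplex module isScalarTower projective

variable {Γ : Type*} [AddMonoid Γ] [DecidableEq Γ] {A B : Type u} [Ring A] [Algebra ℂ A] [Ring B]
  [Algebra ℂ B] {𝒜 : Γ → Submodule ℂ A} {ℬ : Γ → Submodule ℂ B} [GradedAlgebra 𝒜]
  {T : ZhangEquiv 𝒜 ℬ} {h : Γ →+ ℕ} (Res : LinearResolution (coarsen 𝒜 h))

variable (T) in
/-- A lift of a Zhang twist to the `i`-th term of a linear resolution: a compatible family of linear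
equivalences onto the `B`-module induced from the component of degree `i`, under which the
components of that term and the image of the next differential are stable. -/
structure LiftedTerm (i : ℕ) where
  /-- The compatible family of linear equivalences. -/
  equiv : T.ModuleEquiv (Res.P i) (B ⊗[ℂ] Res.deg i i)
  map_deg_self : (Res.deg i i).map (equiv 0).toLinearMap =
    LinearMap.range (TensorProduct.mk ℂ B (Res.deg i i) 1)
  isStable_deg : ∀ j, equiv.IsStable (Res.deg i j)
  isStable_range_d : equiv.IsStable (LinearMap.range ((Res.d i).restrictScalars ℂ))

variable {Res}

theorem isStable_deg_of_isStable_deg_self {N : Type*} [AddCommGroup N] [Module ℂ N] [Module B N]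
    [IsScalarTower ℂ B N] {i : ℕ} {Φ : T.ModuleEquiv (Res.P i) N}
    (hΦ : Φ.IsStable (Res.deg i i)) (j : ℕ) : Φ.IsStable (Res.deg i j) := by
  intro γ
  obtain hij | hij := lt_or_ge j i
  · simp only [Res.deg_eq_bot_of_lt hij, Submodule.map_bot]
  · obtain ⟨m, rfl⟩ := Nat.exists_eq_add_of_le' hij
    simp only [Res.deg_add_eq_smul, hΦ.map_coarsen_smul]

theorem exists_liftedTerm [GradedAlgebra ℬ] (hA : coarsen 𝒜 h 0 ≤ 1) {M N : Type*}
    [AddCommGroup M] [Module ℂ M] [Module A M] [IsScalarTower ℂ A M] [AddCommGroup N] [Module ℂ N]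
    [Module B N] [IsScalarTower ℂ B N] (Φ : T.ModuleEquiv M N) {i : ℕ} {g : Res.P i →ₗ[A] M}
    (hg : Function.Exact (Res.d i) g)
    (hstable : Φ.IsStable ((Res.deg i i).map (g.restrictScalars ℂ))) :
    ∃ (L : Res.LiftedTerm T i) (f : B ⊗[ℂ] Res.deg i i →ₗ[B] N),
      ∀ γ x, f (L.equiv γ x) = Φ γ (g x) := by
  have hker : LinearMap.ker (g.restrictScalars ℂ) = LinearMap.range ((Res.d i).restrictScalars ℂ) :=
    SetLike.ext hg
  have hinj : Function.Injective (g.restrictScalars ℂ ∘ₗ (Res.deg i i).subtype) := by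
    rw [← LinearMap.ker_eq_bot, LinearMap.ker_comp, hker, ← Submodule.disjoint_iff_comap_eq_bot]
    exact Res.disjoint_deg_range_d i
  rw [← Submodule.range_subtype (Res.deg i i), ← LinearMap.range_comp] at hstable
  obtain ⟨ψ, hψ⟩ := Φ.exists_lift hinj hstable
  let Ψ := (T.inducedModuleEquiv ψ).precomp (Res.inducedEquiv hA i).symm
  have hlift : ∀ γ x, inducedLift B ((Φ 0).toLinearMap ∘ₗ g.restrictScalars ℂ ∘ₗ
      (Res.deg i i).subtype) (Ψ γ x) = Φ γ (g x) := fun γ x =>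
    (hψ γ _).trans <| congrArg (Φ γ) <| (inducedLift_restrictScalars_comp g _ _).trans <|
      congrArg g ((Res.inducedEquiv hA i).apply_symm_apply x)
  have hdeg : ∀ γ, (Res.deg i i).map (Ψ γ).toLinearMap =
      LinearMap.range (TensorProduct.mk ℂ B (Res.deg i i) 1) := fun γ => by
    rw [← T.map_inducedModuleEquiv_range_mk_one ψ γ,
      ← (Submodule.map_symm_eq_iff _).2 (Res.map_inducedEquiv_range_mk_one hA i),
      ← Submodule.map_comp]
    rfl
  exact ⟨⟨Ψ, hdeg 0, isStable_deg_of_isStable_deg_self fun γ => (hdeg γ).trans (hdeg 0).symm,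
    hker ▸ ZhangEquiv.ModuleEquiv.isStable_ker (f := (inducedLift B _).restrictScalars ℂ)
      (g := g.restrictScalars ℂ) hlift⟩, _, hlift⟩

namespace LiftedTerm

variable {i : ℕ} (L : Res.LiftedTerm T i)

theorem smul_map_deg_le (m n : ℕ) :
    coarsen ℬ h m • (Res.deg i n).map (L.equiv 0).toLinearMap ≤
      (Res.deg i (m + n)).map (L.equiv 0).toLinearMap :=
  (L.isStable_deg n).map_coarsen_smul h m 0 ▸ Submodule.map_mono (Res.smul_deg_le i m n)

theorem span_map_deg_self :
    Submodule.span B ((Res.deg i i).map (L.equiv 0).toLinearMap : Set (B ⊗[ℂ] Res.deg i i)) =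
      ⊤ := by
  rw [L.map_deg_self, LinearMap.range_eq_map, ← Submodule.baseChange_eq_span,
    Submodule.baseChange_top]

end LiftedTerm

variable (T) (Res) in
/-- A lift of a Zhang twist to a linear resolution: lifts to all terms, together with `B`-linear
maps corresponding to the differentials and the augmentation under every member of the compatible
families. -/
structure Lift [GradedAlgebra ℬ] where
  /-- The lift to each term. -/
  term : ∀ i, Res.LiftedTerm T i
  /-- The lifted differentials. -/
  d : ∀ i, B ⊗[ℂ] Res.deg (i + 1) (i + 1) →ₗ[B] B ⊗[ℂ] Res.deg i i
  d_equiv : ∀ i γ x, d i ((term (i + 1)).equiv γ x) = (term i).equiv γ (Res.d i x)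
  /-- The lifted augmentation. -/
  ε : B ⊗[ℂ] Res.deg 0 0 →ₗ[B] B ⧸ (HomogeneousIdeal.irrelevant (coarsen ℬ h)).toIdeal
  ε_equiv : ∀ γ x, ε ((term 0).equiv γ x) =
    T.quotientModuleEquiv (T.map_irrelevant_coarsen h) γ (Res.ε x)

variable [GradedAlgebra ℬ]

variable (T) (Res) in
theorem nonempty_lift (hA : coarsen 𝒜 h 0 ≤ 1) : Nonempty (Res.Lift T) := by
  obtain ⟨L₀, ε, hε⟩ := exists_liftedTerm hA
    (T.quotientModuleEquiv (T.map_irrelevant_coarsen h)) Res.exact_ε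
    (Res.map_ε_deg.symm ▸ ZhangEquiv.ModuleEquiv.isStable_top)
  choose next d hd using fun i (L : Res.LiftedTerm T i) =>
    exists_liftedTerm hA L.equiv (Res.exact_d i)
      (Res.map_d_deg i (i + 1) ▸ (L.isStable_deg (i + 1)).inf L.isStable_range_d)
  exact ⟨{ term := Nat.rec L₀ next, d := fun i => d i _, d_equiv := fun i => hd i _, ε := ε,
           ε_equiv := hε }⟩

namespace Lift

/-- The linear resolution of the target of a Zhang twist obtained from a lift, its components being
transported along the members with index `0` of the compatible families. -/
def linearResolution (L : Res.Lift T) : LinearResolution (coarsen ℬ h) where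
  P i := B ⊗[ℂ] Res.deg i i
  deg i j := (Res.deg i j).map ((L.term i).equiv 0).toLinearMap
  isInternal i := isInternal_map_equiv (Res.isInternal i) _
  smul_mem i m n b x hb hx :=
    (L.term i).smul_map_deg_le m n (Submodule.smul_mem_smul hb hx)
  projective i := inferInstance
  generated i := (L.term i).span_map_deg_self
  d := L.d
  d_mem := by
    rintro i j _ ⟨x, hx, rfl⟩
    exact ⟨Res.d i x, Res.d_mem i j x hx, (L.d_equiv i 0 x).symm⟩
  ε := L.ε
  ε_eq_zero := by
    rintro j _ hj ⟨x, hx, rfl⟩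
    exact (L.ε_equiv 0 x).trans (by rw [Res.ε_eq_zero j x hj hx, map_zero])
  exact_d i := Function.Exact.of_ladder_linearEquiv_of_exact
    (f₁₂ := (Res.d (i + 1)).restrictScalars ℂ) (f₂₃ := (Res.d i).restrictScalars ℂ)
    (g₁₂ := (L.d (i + 1)).restrictScalars ℂ) (g₂₃ := (L.d i).restrictScalars ℂ)
    (LinearMap.ext (L.d_equiv (i + 1) 0)) (LinearMap.ext (L.d_equiv i 0)) (Res.exact_d i)
  exact_ε := Function.Exact.of_ladder_linearEquiv_of_exact
    (e₃ := T.quotientModuleEquiv (T.map_irrelevant_coarsen h) 0)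
    (f₁₂ := (Res.d 0).restrictScalars ℂ) (f₂₃ := Res.ε.restrictScalars ℂ)
    (g₁₂ := (L.d 0).restrictScalars ℂ) (g₂₃ := L.ε.restrictScalars ℂ)
    (LinearMap.ext (L.d_equiv 0 0)) (LinearMap.ext (L.ε_equiv 0)) Res.exact_ε
  surjective_ε := .of_comp (g := (L.term 0).equiv 0) <|
    (funext (L.ε_equiv 0) : L.ε ∘ (L.term 0).equiv 0 = _) ▸
      (LinearEquiv.surjective _).comp Res.surjective_ε

end Lift

end Lift

end LinearResolution

section Koszul

variable {Γ : Type*} [AddMonoid Γ] [DecidableEq Γ]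

namespace ZhangEquiv

variable {A B : Type u} [Ring A] [Algebra ℂ A] [Ring B] [Algebra ℂ B] {𝒜 : Γ → Submodule ℂ A}
  {ℬ : Γ → Submodule ℂ B} [GradedAlgebra 𝒜] [GradedAlgebra ℬ] {h : Γ →+ ℕ}

theorem isKoszul_coarsen (T : ZhangEquiv 𝒜 ℬ) (hA : coarsen 𝒜 h 0 ≤ 1)
    (hK : IsKoszul (coarsen 𝒜 h)) : IsKoszul (coarsen ℬ h) := by
  obtain ⟨-, ⟨Res⟩⟩ := hK
  obtain ⟨L⟩ := Res.nonempty_lift T hA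
  exact ⟨isSemisimpleRing_zero_of_le_one _ (T.coarsen_zero_le_one hA), ⟨L.linearResolution⟩⟩

theorem isKoszul_coarsen_iff (T : ZhangEquiv 𝒜 ℬ) (hA : coarsen 𝒜 h 0 ≤ 1) :
    IsKoszul (coarsen ℬ h) ↔ IsKoszul (coarsen 𝒜 h) :=
  ⟨T.symm.isKoszul_coarsen (T.coarsen_zero_le_one hA), T.isKoszul_coarsen hA⟩

end ZhangEquiv

theorem TwistingFamily.map_aut {A : Type*} [Ring A] [Algebra ℂ A] {𝒜 : Γ → Submodule ℂ A}
    [GradedAlgebra 𝒜] (τ : TwistingFamily 𝒜) (γ δ : Γ) :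
    (𝒜 δ).map (τ.aut γ).toLinearEquiv.toLinearMap = 𝒜 δ := by
  have h𝒜 := DirectSum.Decomposition.isInternal 𝒜
  rw [map_eq_inf_range_of_isInternal h𝒜 h𝒜 (f := (τ.aut γ).toLinearEquiv.toLinearMap)
    (fun δ => Submodule.map_le_iff_le_comap.2 (τ.map_mem γ δ)) δ, LinearEquiv.range, inf_top_eq]

/-- The Zhang twist from the twisted algebra to `A` given by the automorphisms `τ γ`. -/
def TwistingFamily.zhangEquiv {A : Type*} [Ring A] [Algebra ℂ A] {𝒜 : Γ → Submodule ℂ A}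
    [GradedAlgebra 𝒜] (τ : TwistingFamily 𝒜) : ZhangEquiv (Twist.grading τ) 𝒜 where
  toEquiv γ := (Twist.of τ).symm ≪≫ₗ (τ.aut γ).toLinearEquiv
  map_deg γ δ := by
    refine Eq.trans ?_ (τ.map_aut γ δ)
    rw [Twist.grading, ← Submodule.map_comp]
    rfl
  map_mul_of_mem := by
    rintro γ δ _ ⟨x, hx, rfl⟩ b
    obtain ⟨y, rfl⟩ := (Twist.of τ).surjective b
    have hmul := Twist.of_mul_of τ hx y
    simp [hmul, τ.map_add]

end Koszul

end

theorem propositionA1_general {Γ : Type v} [AddMonoid Γ] [DecidableEq Γ]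
    {A : Type u} [Ring A] [Algebra ℂ A] (𝒜 : Γ → Submodule ℂ A) [GradedAlgebra 𝒜]
    (τ : TwistingFamily 𝒜) (h : Γ →+ ℕ) (hA : coarsen 𝒜 h 0 ≤ 1) :
    IsKoszul (coarsen (Twist.grading τ) h) ↔ IsKoszul (coarsen 𝒜 h) :=
  τ.zhangEquiv.symm.isKoszul_coarsen_iff hA

theorem propositionA1 {Γ : Type v} [AddMonoid Γ] [DecidableEq Γ]
    {A : Type u} [Ring A] [Algebra ℂ A] (𝒜 : Γ → Submodule ℂ A) [GradedAlgebra 𝒜]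
    (τ : TwistingFamily 𝒜) (h : Γ →+ ℕ)
    (hA : Algebra.adjoin ℂ (coarsen 𝒜 h 1 : Set A) = ⊤)
    (hAτ : Algebra.adjoin ℂ (coarsen (Twist.grading τ) h 1 : Set (Twist τ)) = ⊤) :
    IsKoszul (coarsen (Twist.grading τ) h) ↔ IsKoszul (coarsen 𝒜 h) :=
  propositionA1_general 𝒜 τ h (zero_le_one_of_adjoin_eq_top _ hA)
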